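/- Let $n,m,N,M,T$ be positive integers, write $[N]=\{1,\dots,N\}$, and for $k\in\mathbb Z$ let $\lfloor k\rfloor_T$ be the unique element of $[T]$ congruent to $k$ modulo $T$. Let $A_1,\dots,A_N\in\mathbb R^{n\times n}$ and $B_1,\dots,B_N\in\mathbb R^{n\times m}$, and let $P=[p_{ij}]\in\mathbb R^{N\times N}$ and $Q=[q_{ij}]\in\mathbb R^{M\times M}$ be row-stochastic matrices. On a probability space, for every $r_0\in[N]$ let $r=r(\cdot;r_0)$ be a time-homogeneous Markov chain on $[N]$ with transition matrix $P$ and $r(0)=r_0$, and for every $s_0\in[M]$ let $s=s(\cdot;s_0)$ be a time-homogeneous Markov chain on $[M]$ with transition matrix $Q$ and $s(0)=s_0$; assume that $r(\cdot;r_0)$ and $s(\cdot;s_0)$ are independent for all $r_0,s_0$. Let $\Lambda\subset[M]$ be recurrent for $s$: for every $s_0$, almost surely $s(k;s_0)\in\Lambda$ for infinitely many $k$. Let $t_\Lambda(s(\cdot;s_0))=(t_i)_{i\ge0}$ be the increasing enumeration of $\{k\ge 0: s(k;s_0)\in\Lambda\}$, and put $\mathcal T_{s,\Lambda}=\{t_\Lambda(s(\cdot;s_0)):s_0\in[M]\}$.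 Given $t\in\mathcal T_{s,\Lambda}$, an integer $\tau_0<0$ and $\sigma_0\in[N]$, put $\tau(k)=\max\{t_i:t_i\le k\}$ and $\sigma(k)=r(\tau(k))$ if $k\ge t_0$, and $\tau(k)=\tau_0$, $\sigma(k)=\sigma_0$ if $k<t_0$. Gains $K_{\gamma,\delta}\in\mathbb R^{m\times n}$ ($\gamma\in[N]$, $\delta\in[T]$) are said to stabilize $(\Sigma,\mathcal T_{s,\Lambda})$, where $\Sigma$ is the Markov jump linear system $x(k+1)=A_{r(k)}x(k)+B_{r(k)}u(k)$, if there are $C>0$ and $\epsilon\in[0,1)$ such that the solution of $$x(k+1)=\bigl(A_{r(k)}+B_{r(k)}K_{\sigma(k),\lfloor k+1-\tau(k)\rfloor_T}\bigr)x(k),\qquad x(0)=x_0,$$ satisfies $E[\|x(k)\|^2]\le C\epsilon^k\|x_0\|^2$ (Euclidean norm) for all $k\ge0$, $x_0\in\mathbb R^n$, $r_0\in[N]$, $\tau_0<0$, $\sigma_0\in[N]$ and $t\in\mathcal T_{s,\Lambda}$. Let $\bar{\mathfrak X}=[N]\times[M]\times[N]\times[T]$, and for $\chi=(\alpha,\beta,\gamma,\delta)$,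 $\chi'=(\alpha',\beta',\gamma',\delta')$ in $\bar{\mathfrak X}$ let $$\bar p_{\chi,\chi'}=\begin{cases}\mathbf 1(\alpha'=\gamma',\ \delta'=1)\,p_{\alpha\alpha'}q_{\beta\beta'},&\beta'\in\Lambda,\\ \mathbf 1(\gamma'=\gamma,\ \delta'=\lfloor\delta+1\rfloor_T)\,p_{\alpha\alpha'}q_{\beta\beta'},&\beta'\notin\Lambda.\end{cases}$$ For $R=(R_\chi)_{\chi\in\bar{\mathfrak X}}\subset\mathbb R^{n\times n}$ let $\mathcal D_\chi(R)=\sum_{\chi'\in\bar{\mathfrak X}}\bar p_{\chi',\chi}R_{\chi'}$. **Theorem.** Assume that $R_\chi\in\mathbb R^{n\times n}$, $G_{\gamma,\delta}\in\mathbb R^{n\times n}$ and $F_{\gamma,\delta}\in\mathbb R^{m\times n}$ are such that, for all $\chi=(\alpha,\beta,\gamma,\delta)\in\bar{\mathfrak X}$, the matrix $$\begin{bmatrix}R_\chi & A_\alpha G_{\gamma,\delta}+B_\alpha F_{\gamma,\delta}\\ G_{\gamma,\delta}^\top A_\alpha^\top+F_{\gamma,\delta}^\top B_\alpha^\top & G_{\gamma,\delta}+G_{\gamma,\delta}^\top-\mathcal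 D_\chi(R)\end{bmatrix}$$ is symmetric and positive definite. Then every $G_{\gamma,\delta}$ is invertible, and the gains $K_{\gamma,\delta}=F_{\gamma,\delta}G_{\gamma,\delta}^{-1}$ stabilize $(\Sigma,\mathcal T_{s,\Lambda})$. -/

import Mathlib

open MeasureTheory ProbabilityTheory Matrix

noncomputable section

namespace MJLS

/-- The set `[N] = {1, …, N}`. -/
abbrev OneTo (N : ℕ) : Type := ↥(Finset.Icc 1 N)

/-- For `T ≥ 1`, the unique element of `{1, …, T}` that differs from `k` by a multiple of `T`
(see `floorMod_eq_iff`). -/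
def floorMod (T : ℕ) [NeZero T] (k : ℤ) : OneTo T :=
  ⟨((k - 1) % (T : ℤ)).toNat + 1, by
    have hT : (0 : ℤ) < T := by exact_mod_cast Nat.pos_of_ne_zero (NeZero.ne T)
    have h1 := Int.emod_nonneg (k - 1) hT.ne'
    have h2 := Int.emod_lt_of_pos (k - 1) hT
    rw [Finset.mem_Icc]
    omega⟩

theorem floorMod_eq_iff (T : ℕ) [NeZero T] (k : ℤ) (d : OneTo T) :
    floorMod T k = d ↔ (T : ℤ) ∣ k - (d.1 : ℤ) := by
  have hT : (0 : ℤ) < T := by exact_mod_cast Nat.pos_of_ne_zero (NeZero.ne T)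
  have h1 := Int.emod_nonneg (k - 1) hT.ne'
  have hd := Finset.mem_Icc.1 d.2
  have h3 : ((d.1 : ℤ) - 1) % (T : ℤ) = (d.1 : ℤ) - 1 := Int.emod_eq_of_lt (by omega) (by omega)
  have h4 : (T : ℤ) ∣ k - (d.1 : ℤ) ↔ (k - 1) % (T : ℤ) = (d.1 : ℤ) - 1 := by
    rw [← h3, Int.emod_eq_emod_iff_emod_sub_eq_zero, Int.dvd_iff_emod_eq_zero,
      sub_sub_sub_cancel_right]
  rw [h4, Subtype.ext_iff]
  change ((k - 1) % (T : ℤ)).toNat + 1 = d.1 ↔ _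
  omega

variable {Ω : Type*} [MeasurableSpace Ω]

/-- `X` is, under `μ`, a time-homogeneous Markov chain on the finite set `S` with transition
probability matrix `P` and deterministic initial state `i₀`. -/
structure IsMarkovChain {S : Type*} [MeasurableSpace S] (μ : Measure Ω) (P : Matrix S S ℝ)
    (i₀ : S) (X : ℕ → Ω → S) : Prop where
  measurable : ∀ k, Measurable (X k)
  initial : ∀ᵐ ω ∂μ, X 0 ω = i₀
  markov : ∀ (k : ℕ) (i : ℕ → S) (j : S), μ {ω | ∀ l ≤ k, X l ω = i l} ≠ 0 →
    (μ[|{ω | ∀ l ≤ k, X l ω = i l}]).real {ω | X (k + 1) ω = j} = P (i k) j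

/-- `Λ` is recurrent for the chain `s` (`s s₀` is the chain started at `s₀`): from every initial
state, the chain visits `Λ` infinitely often with probability one. -/
def IsRecurrentSet {S : Type*} (μ : Measure Ω) (s : S → ℕ → Ω → S) (Λ : Set S) : Prop :=
  ∀ s₀, ∀ᵐ ω ∂μ, {k : ℕ | s s₀ k ω ∈ Λ}.Infinite

/-- The increasing enumeration `t_Λ(s)` of the times at which the sequence `s` is in `Λ`
(meant for sequences that are in `Λ` infinitely many times). -/
def hitTimes {S : Type*} (Λ : Set S) (s : ℕ → S) (i : ℕ) : ℕ :=
  Nat.nth (fun k => s k ∈ Λ) i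

theorem hitTimes_strictMono {S : Type*} {Λ : Set S} {s : ℕ → S}
    (h : {k : ℕ | s k ∈ Λ}.Infinite) : StrictMono (hitTimes Λ s) :=
  Nat.nth_strictMono h

theorem range_hitTimes {S : Type*} {Λ : Set S} {s : ℕ → S}
    (h : {k : ℕ | s k ∈ Λ}.Infinite) : Set.range (hitTimes Λ s) = {k : ℕ | s k ∈ Λ} :=
  Nat.range_nth_of_infinite h

/-- The family `𝒯_{s,Λ} = {t_Λ(s(·; s₀)) : s₀}` of observation processes. An observation process is
a function `t : ℕ → Ω → ℕ`, with `t i ω` the `i`-th observation time. -/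
def inducedObs {S : Type*} (s : S → ℕ → Ω → S) (Λ : Set S) : Set (ℕ → Ω → ℕ) :=
  {t | ∃ s₀, t = fun i ω => hitTimes Λ (fun k => s s₀ k ω) i}

/-- The last observation time `τ(k)` along one path `t` of the observation process. -/
def tau (t : ℕ → ℕ) (τ₀ : ℤ) (k : ℕ) : ℤ :=
  if t 0 ≤ k then ((sSup {m : ℕ | ∃ i, m = t i ∧ m ≤ k} : ℕ) : ℤ) else τ₀

/-- The last observed Markov state `σ(k)` along paths `r` and `t`. -/
def sigma {S : Type*} (r : ℕ → S) (t : ℕ → ℕ) (τ₀ : ℤ) (σ₀ : S) (k : ℕ) : S :=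
  if t 0 ≤ k then r (tau t τ₀ k).toNat else σ₀

variable {n m N M T : ℕ}

/-- The solution, along paths `r` and `t`, of the closed-loop equation
`x(k+1) = (A_{r(k)} + B_{r(k)} K_{σ(k), ⌊k+1-τ(k)⌋_T}) x(k)`, `x(0) = x₀`. -/
def closedLoop [NeZero T] (A : OneTo N → Matrix (Fin n) (Fin n) ℝ)
    (B : OneTo N → Matrix (Fin n) (Fin m) ℝ) (K : OneTo N → OneTo T → Matrix (Fin m) (Fin n) ℝ)
    (r : ℕ → OneTo N) (t : ℕ → ℕ) (τ₀ : ℤ) (σ₀ : OneTo N) (x₀ : EuclideanSpace ℝ (Fin n)) :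
    ℕ → EuclideanSpace ℝ (Fin n)
  | 0 => x₀
  | k + 1 => Matrix.toEuclideanLin
      (A (r k) + B (r k) * K (sigma r t τ₀ σ₀ k) (floorMod T ((k : ℤ) + 1 - tau t τ₀ k)))
      (closedLoop A B K r t τ₀ σ₀ x₀ k)

/-- The gains `K` stabilize the pair `(Σ, 𝒯)`, that is, the closed loop `(Σ_K, 𝒯)` is mean square
stable. Here `r r₀` is the Markov state process started at `r₀`. -/
def Stabilizes [NeZero T] (μ : Measure Ω) (A : OneTo N → Matrix (Fin n) (Fin n) ℝ)
    (B : OneTo N → Matrix (Fin n) (Fin m) ℝ) (r : OneTo N → ℕ → Ω → OneTo N)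
    (𝒯 : Set (ℕ → Ω → ℕ)) (K : OneTo N → OneTo T → Matrix (Fin m) (Fin n) ℝ) : Prop :=
  ∃ C > (0 : ℝ), ∃ ε ∈ Set.Ico (0 : ℝ) 1,
    ∀ (x₀ : EuclideanSpace ℝ (Fin n)) (r₀ : OneTo N) (τ₀ : ℤ) (σ₀ : OneTo N), τ₀ < 0 →
      ∀ t ∈ 𝒯, ∀ k : ℕ,
        Integrable (fun ω =>
          ‖closedLoop A B K (fun j => r r₀ j ω) (fun i => t i ω) τ₀ σ₀ x₀ k‖ ^ 2) μ ∧
        ∫ ω, ‖closedLoop A B K (fun j => r r₀ j ω) (fun i => t i ω) τ₀ σ₀ x₀ k‖ ^ 2 ∂μ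
          ≤ C * ε ^ k * ‖x₀‖ ^ 2

/-- The extended Markov-state space `[N] × [M] × [N] × [T]`. -/
abbrev ExtState (N M T : ℕ) : Type := OneTo N × OneTo M × OneTo N × OneTo T

open Classical in
/-- The transition probabilities `p̄_{χ,χ'}` of the extended chain
`(r(k), s(k), σ(k), ⌊k+1-τ(k)⌋_T)`. -/
def extTrans [NeZero T] (P : Matrix (OneTo N) (OneTo N) ℝ) (Q : Matrix (OneTo M) (OneTo M) ℝ)
    (Λ : Set (OneTo M)) : ExtState N M T → ExtState N M T → ℝ
  | (α, β, γ, δ), (α', β', γ', δ') =>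
    if β' ∈ Λ then
      if α' = γ' ∧ δ'.1 = 1 then P α α' * Q β β' else 0
    else
      if γ' = γ ∧ δ' = floorMod T ((δ.1 : ℤ) + 1) then P α α' * Q β β' else 0

/-- `𝒟_χ(R) = ∑_{χ'} p̄_{χ',χ} R_{χ'}`. -/
def calD [NeZero T] (P : Matrix (OneTo N) (OneTo N) ℝ) (Q : Matrix (OneTo M) (OneTo M) ℝ)
    (Λ : Set (OneTo M)) (R : ExtState N M T → Matrix (Fin n) (Fin n) ℝ) (χ : ExtState N M T) :
    Matrix (Fin n) (Fin n) ℝ :=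
  ∑ χ' : ExtState N M T, extTrans P Q Λ χ' χ • R χ'

end MJLS

end

/-! Along a path with infinitely many visits to `Λ`, the quadruple χ(k) = (r(k), s(k), σ(k),
⌊k+1-τ(k)⌋_T) is obtained recursively from the pair chain (r, s), and the closed loop becomes x(k+1)
= H_χ(k) x(k) with H_χ = A_α + B_α K_{γ,δ}. The matrix inequality, tested on (v, -H_χᵀ v), says that
H_χ 𝒟_χ(R) H_χᵀ < R_χ (`quadForm_transpose_lt_of_fromBlocks`); by compactness the left side is at
most ε R_χ with a single ε < 1. The moments Y_χ(k) = E[H_χ x(k) x(k)ᵀ H_χᵀ 1(χ(k) = χ)] obey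
Y_χ(k+1) = H_χ 𝒟_χ(Y(k)) H_χᵀ (`stateMoment_succ`). Since 𝒟 preserves order, Y(0) ≤ C‖x₀‖² R
propagates to Y(k) ≤ C ε^k ‖x₀‖² R (`stateMoment_le`), and summing traces over χ bounds E‖x(k+1)‖².
All matrix inequalities are handled through quadratic forms. -/

namespace MJLS

/-! ### Comparison of quadratic forms -/

section QuadraticForms

/-- The quotient of the two forms is bounded on the compact unit sphere, and both are homogeneous of
degree two. -/
theorem exists_quadForm_le {n : ℕ} (W V : Matrix (Fin n) (Fin n) ℝ)
    (hV : ∀ v, v ≠ 0 → 0 < v ⬝ᵥ V *ᵥ v) :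
    ∃ C > 0, ∀ v, v ⬝ᵥ W *ᵥ v ≤ C * (v ⬝ᵥ V *ᵥ v) := by
  have hcont : ∀ U : Matrix (Fin n) (Fin n) ℝ, Continuous fun v : Fin n → ℝ => v ⬝ᵥ U *ᵥ v :=
    fun U => by fun_prop
  have hne : ∀ v ∈ Metric.sphere (0 : Fin n → ℝ) 1, v ≠ 0 := fun v hv h => by
    simp [h] at hv
  obtain ⟨C, hC⟩ := (isCompact_sphere (0 : Fin n → ℝ) 1).exists_bound_of_continuousOn
    (f := fun v => (v ⬝ᵥ W *ᵥ v) / (v ⬝ᵥ V *ᵥ v))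
    ((hcont W).continuousOn.div (hcont V).continuousOn fun v hv => (hV v (hne v hv)).ne')
  refine ⟨max C 1, by positivity, fun v => ?_⟩
  by_cases hv : v = 0
  · simp [hv]
  have hnv : ‖v‖ ≠ 0 := norm_ne_zero_iff.2 hv
  have hscale : ∀ U : Matrix (Fin n) (Fin n) ℝ,
      v ⬝ᵥ U *ᵥ v = ‖v‖ ^ 2 * ((‖v‖⁻¹ • v) ⬝ᵥ U *ᵥ (‖v‖⁻¹ • v)) := fun U => by
    simp only [mulVec_smul, smul_dotProduct, dotProduct_smul, smul_eq_mul]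
    field_simp
  have hu : ‖v‖⁻¹ • v ∈ Metric.sphere (0 : Fin n → ℝ) 1 := by
    simp [norm_smul, hnv]
  have h1 := (le_abs_self _).trans (hC _ hu)
  have h2 := hV _ (hne _ hu)
  rw [div_le_iff₀ h2] at h1
  rw [hscale W, hscale V, mul_left_comm]
  have h3 : C ≤ max C 1 := le_max_left _ _
  gcongr
  exact h1.trans (by gcongr)

/-- Rearranging V ≤ C (V - W) gives W ≤ (1 - 1/C) V. -/
theorem exists_quadForm_le_contraction {n : ℕ} (W V : Matrix (Fin n) (Fin n) ℝ)
    (hWV : ∀ v, v ≠ 0 → v ⬝ᵥ W *ᵥ v < v ⬝ᵥ V *ᵥ v) :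
    ∃ ε < 1, ∀ v, v ⬝ᵥ W *ᵥ v ≤ ε * (v ⬝ᵥ V *ᵥ v) := by
  obtain ⟨C, hC, h⟩ := exists_quadForm_le V (V - W) fun v hv => by
    rw [sub_mulVec, dotProduct_sub]
    exact sub_pos.2 (hWV v hv)
  refine ⟨1 - C⁻¹, by simpa using hC, fun v => ?_⟩
  have := h v
  rw [sub_mulVec, dotProduct_sub] at this
  have h2 := mul_le_mul_of_nonneg_left this (inv_nonneg.2 hC.le)
  rw [inv_mul_cancel_left₀ hC.ne'] at h2
  linarith

end QuadraticForms

/-! ### Consequences of the linear matrix inequality -/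

section MatrixInequality

variable {n m N M T : ℕ}

theorem extTrans_nonneg [NeZero T] {P : Matrix (OneTo N) (OneTo N) ℝ}
    {Q : Matrix (OneTo M) (OneTo M) ℝ} (hP : ∀ i j, 0 ≤ P i j) (hQ : ∀ i j, 0 ≤ Q i j)
    (Λ : Set (OneTo M)) (χ χ' : ExtState N M T) : 0 ≤ extTrans P Q Λ χ χ' := by
  obtain ⟨α, β, γ, δ⟩ := χ
  obtain ⟨α', β', γ', δ'⟩ := χ'
  have := mul_nonneg (hP α α') (hQ β β')
  simp only [extTrans]
  split_ifs <;> first | exact this | exact le_rfl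

theorem dotProduct_calD_mulVec [NeZero T] (P : Matrix (OneTo N) (OneTo N) ℝ)
    (Q : Matrix (OneTo M) (OneTo M) ℝ) (Λ : Set (OneTo M))
    (R : ExtState N M T → Matrix (Fin n) (Fin n) ℝ) (χ : ExtState N M T) (u : Fin n → ℝ) :
    u ⬝ᵥ calD P Q Λ R χ *ᵥ u = ∑ χ', extTrans P Q Λ χ' χ * (u ⬝ᵥ R χ' *ᵥ u) := by
  simp [calD, Matrix.sum_mulVec, dotProduct_sum, smul_mulVec, dotProduct_smul]

theorem fromBlocks_quadForm (U : Matrix (Fin n) (Fin n) ℝ) (X : Matrix (Fin n) (Fin m) ℝ)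
    (Y : Matrix (Fin m) (Fin n) ℝ) (Z : Matrix (Fin m) (Fin m) ℝ) (v : Fin n → ℝ) (w : Fin m → ℝ) :
    Sum.elim v w ⬝ᵥ fromBlocks U X Y Z *ᵥ Sum.elim v w =
      v ⬝ᵥ U *ᵥ v + v ⬝ᵥ X *ᵥ w + w ⬝ᵥ Y *ᵥ v + w ⬝ᵥ Z *ᵥ w := by
  rw [fromBlocks_mulVec, sumElim_dotProduct_sumElim]
  simp only [Sum.elim_comp_inl, Sum.elim_comp_inr, dotProduct_add]
  ring

theorem quadForm_pos_of_fromBlocks {U : Matrix (Fin n) (Fin n) ℝ}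
    {X : Matrix (Fin n) (Fin m) ℝ} {Y : Matrix (Fin m) (Fin n) ℝ} {Z : Matrix (Fin m) (Fin m) ℝ}
    (h : (fromBlocks U X Y Z).PosDef) {v : Fin n → ℝ} {w : Fin m → ℝ} (hvw : v ≠ 0 ∨ w ≠ 0) :
    0 < v ⬝ᵥ U *ᵥ v + v ⬝ᵥ X *ᵥ w + w ⬝ᵥ Y *ᵥ v + w ⬝ᵥ Z *ᵥ w := by
  rw [← fromBlocks_quadForm]
  have hne : Sum.elim v w ≠ 0 := fun h0 => by
    rcases hvw with hv | hw
    · exact hv (funext fun i => congrFun h0 (Sum.inl i))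
    · exact hw (funext fun i => congrFun h0 (Sum.inr i))
  simpa using h.dotProduct_mulVec_pos hne

/-- On a kernel vector of `G` the form of `G + Gᵀ` vanishes, leaving only the nonpositive term from
`-D`. -/
theorem isUnit_of_quadForm_pos {G D : Matrix (Fin n) (Fin n) ℝ}
    (hD : ∀ v, 0 ≤ v ⬝ᵥ D *ᵥ v) (h : ∀ v, v ≠ 0 → 0 < v ⬝ᵥ (G + Gᵀ - D) *ᵥ v) : IsUnit G := by
  rw [← mulVec_injective_iff_isUnit]
  refine (injective_iff_map_eq_zero G.mulVecLin).2 fun v hv => ?_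
  by_contra hne
  have h1 := h v hne
  have hv' : G *ᵥ v = 0 := hv
  rw [sub_mulVec, add_mulVec, dotProduct_sub, dotProduct_add, dotProduct_mulVec v Gᵀ,
    vecMul_transpose, hv'] at h1
  have h2 := hD v
  simp at h1
  linarith

/-- With K the closed-loop matrix, the off-diagonal blocks are K G and its transpose. On (v, -Kᵀ v)
all terms in `G` cancel, so neither a Schur complement nor an inverse of `D` is needed. -/
theorem quadForm_transpose_lt_of_fromBlocks {U A G D : Matrix (Fin n) (Fin n) ℝ}
    {B : Matrix (Fin n) (Fin m) ℝ} {F : Matrix (Fin m) (Fin n) ℝ} (hG : IsUnit G)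
    (h : (fromBlocks U (A * G + B * F) (Gᵀ * Aᵀ + Fᵀ * Bᵀ) (G + Gᵀ - D)).PosDef)
    (v : Fin n → ℝ) (hv : v ≠ 0) :
    ((A + B * (F * G⁻¹))ᵀ *ᵥ v) ⬝ᵥ D *ᵥ ((A + B * (F * G⁻¹))ᵀ *ᵥ v) < v ⬝ᵥ U *ᵥ v := by
  set K := A + B * (F * G⁻¹) with hK
  have hKG : A * G + B * F = K * G := by
    rw [hK, add_mul, Matrix.mul_assoc B, Matrix.mul_assoc F,
      Matrix.nonsing_inv_mul _ ((Matrix.isUnit_iff_isUnit_det _).1 hG), Matrix.mul_one]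
  have hKG' : Gᵀ * Aᵀ + Fᵀ * Bᵀ = Gᵀ * Kᵀ := by
    rw [← transpose_mul, ← transpose_mul, ← transpose_mul, ← transpose_add, hKG]
  rw [hKG, hKG'] at h
  have h1 := quadForm_pos_of_fromBlocks h (w := -(Kᵀ *ᵥ v)) (Or.inl hv)
  set u := Kᵀ *ᵥ v with hu
  have e1 : v ⬝ᵥ (K * G) *ᵥ (-u) = -(u ⬝ᵥ G *ᵥ u) := by
    rw [mulVec_neg, dotProduct_neg, ← mulVec_mulVec, dotProduct_mulVec v K, ← mulVec_transpose]
  have e2 : (-u) ⬝ᵥ (Gᵀ * Kᵀ) *ᵥ v = -(u ⬝ᵥ Gᵀ *ᵥ u) := by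
    rw [← mulVec_mulVec, neg_dotProduct]
  have e3 : (-u) ⬝ᵥ (G + Gᵀ - D) *ᵥ (-u) = u ⬝ᵥ G *ᵥ u + u ⬝ᵥ Gᵀ *ᵥ u - u ⬝ᵥ D *ᵥ u := by
    rw [mulVec_neg, neg_dotProduct, dotProduct_neg, neg_neg, sub_mulVec, add_mulVec,
      dotProduct_sub, dotProduct_add]
  rw [e1, e2, e3] at h1
  linarith

end MatrixInequality

/-! ### Finite Markov chains and their one-step expectations -/

section MarkovChains

variable {Ω : Type*} [MeasurableSpace Ω] {μ : Measure Ω}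
  {S S' : Type*} [MeasurableSpace S] [MeasurableSpace S']
  [MeasurableSingletonClass S] [MeasurableSingletonClass S']

theorem IsMarkovChain.measurableSet_history {P : Matrix S S ℝ} {i₀ : S} {X : ℕ → Ω → S}
    (hX : IsMarkovChain μ P i₀ X) (k : ℕ) (i : ℕ → S) :
    MeasurableSet {ω | ∀ l ≤ k, X l ω = i l} := by
  simp only [Set.ofPred_forall]
  exact MeasurableSet.iInter fun l => MeasurableSet.iInter fun _ =>
    hX.measurable l (measurableSet_singleton _)

/-- The product form of the Markov property also covers histories of probability zero. -/
theorem IsMarkovChain.measureReal_history_succ [IsFiniteMeasure μ] {P : Matrix S S ℝ} {i₀ : S}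
    {X : ℕ → Ω → S} (hX : IsMarkovChain μ P i₀ X) (k : ℕ) (i : ℕ → S) (j : S) :
    μ.real ({ω | ∀ l ≤ k, X l ω = i l} ∩ {ω | X (k + 1) ω = j}) =
      P (i k) j * μ.real {ω | ∀ l ≤ k, X l ω = i l} := by
  by_cases h0 : μ {ω | ∀ l ≤ k, X l ω = i l} = 0
  · rw [Measure.real, measure_inter_null_of_null_left _ h0, Measure.real, h0]
    simp
  · rw [← hX.markov k i j h0, Measure.real, Measure.real, Measure.real, ← ENNReal.toReal_mul,
      cond_mul_eq_inter (hX.measurableSet_history k i)]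

theorem measurableSet_cylinder (k : ℕ) (i : ℕ → S) :
    MeasurableSet {x : ℕ → S | ∀ l ≤ k, x l = i l} := by
  simp only [Set.ofPred_forall]
  exact MeasurableSet.iInter fun l => MeasurableSet.iInter fun _ =>
    measurable_pi_apply l (measurableSet_singleton _)

theorem measurableSet_coordinate (k : ℕ) (j : S) : MeasurableSet {x : ℕ → S | x k = j} :=
  measurable_pi_apply k (measurableSet_singleton _)

/-- Independence of the whole paths factorises the probability of a joint history, both with and
without the next step. -/
theorem IsMarkovChain.prod [IsFiniteMeasure μ] {P : Matrix S S ℝ} {Q : Matrix S' S' ℝ} {i₀ : S}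
    {j₀ : S'} {X : ℕ → Ω → S} {Y : ℕ → Ω → S'} (hX : IsMarkovChain μ P i₀ X)
    (hY : IsMarkovChain μ Q j₀ Y) (hXY : IndepFun (fun ω k => X k ω) (fun ω k => Y k ω) μ) :
    IsMarkovChain μ (Matrix.of fun a b : S × S' => P a.1 b.1 * Q a.2 b.2) (i₀, j₀)
      (fun k ω => (X k ω, Y k ω)) where
  measurable k := (hX.measurable k).prodMk (hY.measurable k)
  initial := by
    filter_upwards [hX.initial, hY.initial] with ω h1 h2
    rw [h1, h2]
  markov k i j h0 := by
    have hsplit : {ω | ∀ l ≤ k, (X l ω, Y l ω) = i l} =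
        {ω | ∀ l ≤ k, X l ω = (i l).1} ∩ {ω | ∀ l ≤ k, Y l ω = (i l).2} := by
      ext ω
      simp only [Set.mem_ofPred_eq, Set.mem_inter_iff, Prod.ext_iff]
      exact ⟨fun h => ⟨fun l hl => (h l hl).1, fun l hl => (h l hl).2⟩,
        fun h l hl => ⟨h.1 l hl, h.2 l hl⟩⟩
    have hsplit' : {ω | ∀ l ≤ k, (X l ω, Y l ω) = i l} ∩ {ω | (X (k + 1) ω, Y (k + 1) ω) = j} =
        ({ω | ∀ l ≤ k, X l ω = (i l).1} ∩ {ω | X (k + 1) ω = j.1}) ∩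
        ({ω | ∀ l ≤ k, Y l ω = (i l).2} ∩ {ω | Y (k + 1) ω = j.2}) := by
      rw [hsplit]
      ext ω
      simp only [Set.mem_ofPred_eq, Set.mem_inter_iff, Prod.ext_iff]
      tauto
    have h1 := hXY.measure_inter_preimage_eq_mul _ _ (measurableSet_cylinder k fun l => (i l).1)
      (measurableSet_cylinder k fun l => (i l).2)
    have h2 := hXY.measure_inter_preimage_eq_mul _ _
      ((measurableSet_cylinder k fun l => (i l).1).inter (measurableSet_coordinate (k + 1) j.1))
      ((measurableSet_cylinder k fun l => (i l).2).inter (measurableSet_coordinate (k + 1) j.2))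
    have hmeas : MeasurableSet {ω | ∀ l ≤ k, (X l ω, Y l ω) = i l} := by
      rw [hsplit]
      exact (hX.measurableSet_history k _).inter (hY.measurableSet_history k _)
    have e1 : μ.real {ω | ∀ l ≤ k, (X l ω, Y l ω) = i l} =
        μ.real {ω | ∀ l ≤ k, X l ω = (i l).1} * μ.real {ω | ∀ l ≤ k, Y l ω = (i l).2} := by
      rw [hsplit, Measure.real, Measure.real, Measure.real, ← ENNReal.toReal_mul]
      exact congrArg ENNReal.toReal h1
    have e2 : μ.real ({ω | ∀ l ≤ k, (X l ω, Y l ω) = i l} ∩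
        {ω | (X (k + 1) ω, Y (k + 1) ω) = j}) =
        μ.real ({ω | ∀ l ≤ k, X l ω = (i l).1} ∩ {ω | X (k + 1) ω = j.1}) *
        μ.real ({ω | ∀ l ≤ k, Y l ω = (i l).2} ∩ {ω | Y (k + 1) ω = j.2}) := by
      rw [hsplit', Measure.real, Measure.real, Measure.real, ← ENNReal.toReal_mul]
      exact congrArg ENNReal.toReal h2
    have e0 : μ.real {ω | ∀ l ≤ k, (X l ω, Y l ω) = i l} ≠ 0 :=
      ENNReal.toReal_ne_zero.2 ⟨h0, measure_ne_top _ _⟩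
    have e3 := congrArg ENNReal.toReal
      (cond_mul_eq_inter hmeas {ω | (X (k + 1) ω, Y (k + 1) ω) = j} μ)
    rw [ENNReal.toReal_mul] at e3
    change (μ[|_]).real _ * μ.real _ = μ.real _ at e3
    rw [e2, hX.measureReal_history_succ k (fun l => (i l).1),
      hY.measureReal_history_succ k (fun l => (i l).2)] at e3
    refine mul_right_cancel₀ e0 (e3.trans ?_)
    rw [e1, Matrix.of_apply]
    ring

/-- `f` is a function of the values of the process `X` at the times `0, …, k`. -/
def DependsOnHistory {Ω S E : Type*} (X : ℕ → Ω → S) (k : ℕ) (f : Ω → E) : Prop :=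
  ∀ ω ω', (∀ l ≤ k, X l ω = X l ω') → f ω = f ω'

theorem DependsOnHistory.exists_eq {Ω S E : Type*} [Nonempty E] {X : ℕ → Ω → S} {k : ℕ} {f : Ω → E}
    (hf : DependsOnHistory X k f) :
    ∃ g : (Fin (k + 1) → S) → E, ∀ ω, f ω = g fun l => X l ω := by
  have hfac : Function.FactorsThrough f (fun ω (l : Fin (k + 1)) => X l ω) := fun ω ω' h =>
    hf ω ω' fun l hl => congrFun h ⟨l, Nat.lt_succ_of_le hl⟩
  exact ⟨Function.extend (fun ω (l : Fin (k + 1)) => X l ω) f fun _ => Classical.arbitrary E,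
    fun ω => (hfac.extend_apply _ ω).symm⟩

/-- A history takes finitely many values, so measurability and boundedness are automatic. -/
theorem DependsOnHistory.integrable [IsFiniteMeasure μ] [Finite S] {X : ℕ → Ω → S}
    (hX : ∀ k, Measurable (X k)) {k : ℕ} {f : Ω → ℝ} (hf : DependsOnHistory X k f) :
    Integrable f μ := by
  obtain ⟨g, hg⟩ := hf.exists_eq
  have hH : Measurable fun ω (l : Fin (k + 1)) => X l ω := measurable_pi_lambda _ fun l => hX l
  rw [show f = g ∘ fun ω (l : Fin (k + 1)) => X l ω from funext hg]
  exact (Integrable.of_finite (μ := μ.map fun ω (l : Fin (k + 1)) => X l ω)).comp_measurable hH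

theorem integral_comp_eq_sum {E : Type*} [Fintype E] [MeasurableSpace E]
    [MeasurableSingletonClass E] [IsFiniteMeasure μ] {H : Ω → E} (hH : Measurable H) (g : E → ℝ) :
    ∫ ω, g (H ω) ∂μ = ∑ h, μ.real {ω | H ω = h} * g h := by
  rw [← integral_map (f := g) hH.aemeasurable Integrable.of_finite.aestronglyMeasurable,
    integral_fintype Integrable.of_finite]
  refine Finset.sum_congr rfl fun h _ => ?_
  rw [map_measureReal_apply hH (measurableSet_singleton h), smul_eq_mul]
  rfl

/-- Sum over histories: every one that contributes ends in `a`, so the Markov property yields the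
same factor `P a b` each time. -/
theorem IsMarkovChain.integral_mul_indicator_succ [IsFiniteMeasure μ] [Finite S] [DecidableEq S]
    {P : Matrix S S ℝ} {i₀ : S} {X : ℕ → Ω → S} (hX : IsMarkovChain μ P i₀ X) {k : ℕ} {f : Ω → ℝ}
    (hf : DependsOnHistory X k f) {a : S} (ha : ∀ ω, f ω ≠ 0 → X k ω = a) (b : S) :
    ∫ ω, f ω * (if X (k + 1) ω = b then 1 else 0) ∂μ = P a b * ∫ ω, f ω ∂μ := by
  have := Fintype.ofFinite S
  obtain ⟨g, hg⟩ := hf.exists_eq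
  have hH : Measurable fun ω (l : Fin (k + 1)) => X l ω :=
    measurable_pi_lambda _ fun l => hX.measurable l
  have hHX := hH.prodMk (hX.measurable (k + 1))
  have h1 := integral_comp_eq_sum (μ := μ) hHX (fun p => g p.1 * if p.2 = b then 1 else 0)
  have h2 := integral_comp_eq_sum (μ := μ) hH g
  simp only [hg]
  rw [h1, h2, Fintype.sum_prod_type, Finset.mul_sum]
  refine Finset.sum_congr rfl fun h _ => ?_
  rw [Finset.sum_eq_single b (fun x _ hx => by simp [hx]) (by simp)]
  -- The value `b` is mere padding beyond time `k`.
  have hset : {ω | (fun l : Fin (k + 1) => X l ω) = h} =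
      {ω | ∀ l ≤ k, X l ω = if hl : l < k + 1 then h ⟨l, hl⟩ else b} := by
    ext ω
    simp only [Set.mem_ofPred_eq, funext_iff]
    constructor
    · intro H l hl
      rw [dif_pos (Nat.lt_succ_of_le hl)]
      exact H ⟨l, _⟩
    · rintro H ⟨l, hl⟩
      have := H l (Nat.le_of_lt_succ hl)
      rwa [dif_pos hl] at this
  have hset' : {ω | ((fun l : Fin (k + 1) => X l ω), X (k + 1) ω) = (h, b)} =
      {ω | (fun l : Fin (k + 1) => X l ω) = h} ∩ {ω | X (k + 1) ω = b} := by
    ext ω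
    simp
  rw [hset', hset, hX.measureReal_history_succ, ← hset, if_pos rfl, mul_one, mul_assoc,
    dif_pos (Nat.lt_succ_self k)]
  by_cases h0 : μ.real {ω | (fun l : Fin (k + 1) => X l ω) = h} * g h = 0
  · rw [h0]; simp
  -- `g` is arbitrary on histories that never occur, so `ha` has to be used at an actual sample
  -- point.
  · obtain ⟨ω, hω⟩ : {ω | (fun l : Fin (k + 1) => X l ω) = h}.Nonempty := by
      by_contra hemp
      rw [Set.not_nonempty_iff_eq_empty] at hemp
      simp [hemp] at h0
    have hfω : f ω ≠ 0 := by
      rw [hg, show (fun l : Fin (k + 1) => X l ω) = h from hω]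
      exact right_ne_zero_of_mul h0
    congr 2
    rw [← ha ω hfω]
    exact (congrFun hω ⟨k, Nat.lt_succ_self k⟩).symm

end MarkovChains

/-! ### The extended chain as a function of the path of (r, s) -/

section ExtendedState

variable {n m N M T : ℕ}

theorem floorMod_floorMod_add_one [NeZero T] (k : ℤ) :
    floorMod T (((floorMod T k).1 : ℤ) + 1) = floorMod T (k + 1) := by
  rw [floorMod_eq_iff]
  have h1 := (floorMod_eq_iff T k _).1 rfl
  have h2 := (floorMod_eq_iff T (k + 1) _).1 rfl
  obtain ⟨a, ha⟩ := h1
  obtain ⟨b, hb⟩ := h2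
  exact ⟨b - a, by linear_combination hb - ha⟩

theorem floorMod_one_eq_iff [NeZero T] (d : OneTo T) : floorMod T 1 = d ↔ d.1 = 1 := by
  have h : (floorMod T 1).1 = 1 := by simp [floorMod]
  rw [Subtype.ext_iff, h, eq_comm]

open Classical in
/-- The state of the extended chain after `χ`, when `z` is the next value of `(r, s)`. -/
noncomputable def nextExt [NeZero T] (Λ : Set (OneTo M)) (χ : ExtState N M T)
    (z : OneTo N × OneTo M) : ExtState N M T :=
  if z.2 ∈ Λ then (z.1, z.2, z.1, floorMod T 1)
  else (z.1, z.2, χ.2.2.1, floorMod T ((χ.2.2.2.1 : ℤ) + 1))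

theorem nextExt_fst [NeZero T] (Λ : Set (OneTo M)) (χ : ExtState N M T) (z : OneTo N × OneTo M) :
    (nextExt Λ χ z).1 = z.1 := by
  unfold nextExt
  split_ifs <;> rfl

theorem nextExt_snd [NeZero T] (Λ : Set (OneTo M)) (χ : ExtState N M T) (z : OneTo N × OneTo M) :
    (nextExt Λ χ z).2.1 = z.2 := by
  unfold nextExt
  split_ifs <;> rfl

/-- All randomness sits in (r, s): given χ and the next pair, the next extended state is determined.
-/
theorem extTrans_eq_ite [NeZero T] (P : Matrix (OneTo N) (OneTo N) ℝ)
    (Q : Matrix (OneTo M) (OneTo M) ℝ) (Λ : Set (OneTo M)) (χ χ' : ExtState N M T) :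
    extTrans P Q Λ χ χ' =
      if nextExt Λ χ (χ'.1, χ'.2.1) = χ' then P χ.1 χ'.1 * Q χ.2.1 χ'.2.1 else 0 := by
  obtain ⟨α, β, γ, δ⟩ := χ
  obtain ⟨α', β', γ', δ'⟩ := χ'
  by_cases h : β' ∈ Λ
  · simp [extTrans, nextExt, h, floorMod_one_eq_iff]
  · simp only [extTrans, nextExt, h, if_false, Prod.mk.injEq, true_and]
    simp only [eq_comm]

/-- The path of the extended chain along the path `z` of `(r, s)`, from the state `χ₀` at time
`-1`. -/
noncomputable def extPath [NeZero T] (Λ : Set (OneTo M)) (χ₀ : ExtState N M T)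
    (z : ℕ → OneTo N × OneTo M) : ℕ → ExtState N M T
  | 0 => nextExt Λ χ₀ (z 0)
  | k + 1 => nextExt Λ (extPath Λ χ₀ z k) (z (k + 1))

theorem extPath_fst [NeZero T] (Λ : Set (OneTo M)) (χ₀ : ExtState N M T)
    (z : ℕ → OneTo N × OneTo M) (k : ℕ) : (extPath Λ χ₀ z k).1 = (z k).1 := by
  cases k <;> exact nextExt_fst _ _ _

theorem extPath_snd [NeZero T] (Λ : Set (OneTo M)) (χ₀ : ExtState N M T)
    (z : ℕ → OneTo N × OneTo M) (k : ℕ) : (extPath Λ χ₀ z k).2.1 = (z k).2 := by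
  cases k <;> exact nextExt_snd _ _ _

theorem extPath_congr [NeZero T] (Λ : Set (OneTo M)) (χ₀ : ExtState N M T)
    {z z' : ℕ → OneTo N × OneTo M} {k : ℕ} (h : ∀ l ≤ k, z l = z' l) :
    extPath Λ χ₀ z k = extPath Λ χ₀ z' k := by
  induction k with
  | zero => simp only [extPath, h 0 le_rfl]
  | succ k ih => simp only [extPath, h (k + 1) le_rfl, ih fun l hl => h l (hl.trans k.le_succ)]

/-- The solution of `x(k+1) = H_{χ(k)} x(k)`, `x(0) = x₀`, along the path of the extended chain. -/
noncomputable def jumpState [NeZero T] (H : ExtState N M T → Matrix (Fin n) (Fin n) ℝ)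
    (Λ : Set (OneTo M)) (χ₀ : ExtState N M T) (x₀ : Fin n → ℝ) (z : ℕ → OneTo N × OneTo M) : ℕ → Fin n → ℝ
  | 0 => x₀
  | k + 1 => H (extPath Λ χ₀ z k) *ᵥ jumpState H Λ χ₀ x₀ z k

theorem jumpState_congr [NeZero T] (H : ExtState N M T → Matrix (Fin n) (Fin n) ℝ)
    (Λ : Set (OneTo M)) (χ₀ : ExtState N M T) (x₀ : Fin n → ℝ) {z z' : ℕ → OneTo N × OneTo M}
    {k : ℕ} (h : ∀ l ≤ k, z l = z' l) : jumpState H Λ χ₀ x₀ z k = jumpState H Λ χ₀ x₀ z' k := by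
  induction k with
  | zero => rfl
  | succ k ih =>
    have h' : ∀ l ≤ k, z l = z' l := fun l hl => h l (hl.trans k.le_succ)
    simp only [jumpState, extPath_congr Λ χ₀ h', ih h']

end ExtendedState

/-! ### One-step behaviour of τ and σ -/

section ObservationTimes

variable {S S' : Type*} {Λ : Set S'} {s : ℕ → S'}

/-- Infinitude excludes the default value 0 that `Nat.nth` takes when there is no such visit. -/
theorem hitTimes_zero_le_iff (h : {k : ℕ | s k ∈ Λ}.Infinite) (k : ℕ) :
    hitTimes Λ s 0 ≤ k ↔ ∃ l ≤ k, s l ∈ Λ := by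
  have hr := Set.ext_iff.1 (range_hitTimes h)
  constructor
  · exact fun hk => ⟨_, hk, (hr _).1 ⟨0, rfl⟩⟩
  · rintro ⟨l, hl, hs⟩
    obtain ⟨i, rfl⟩ := (hr l).2 hs
    exact ((hitTimes_strictMono h).monotone (Nat.zero_le i)).trans hl

theorem setOf_hitTimes_le (h : {k : ℕ | s k ∈ Λ}.Infinite) (k : ℕ) :
    {l : ℕ | ∃ i, l = hitTimes Λ s i ∧ l ≤ k} = {l | s l ∈ Λ ∧ l ≤ k} := by
  have hr := Set.ext_iff.1 (range_hitTimes h)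
  ext l
  constructor
  · rintro ⟨i, rfl, hk⟩
    exact ⟨(hr _).1 ⟨i, rfl⟩, hk⟩
  · rintro ⟨hs, hk⟩
    obtain ⟨i, rfl⟩ := (hr l).2 hs
    exact ⟨i, rfl, hk⟩

theorem tau_of_mem (h : {k : ℕ | s k ∈ Λ}.Infinite) (τ₀ : ℤ) {k : ℕ} (hk : s k ∈ Λ) :
    tau (hitTimes Λ s) τ₀ k = k := by
  rw [tau, if_pos ((hitTimes_zero_le_iff h k).2 ⟨k, le_rfl, hk⟩), setOf_hitTimes_le h]
  have : IsGreatest {l | s l ∈ Λ ∧ l ≤ k} k := ⟨⟨hk, le_rfl⟩, fun l hl => hl.2⟩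
  rw [this.csSup_eq]

theorem sigma_of_mem (h : {k : ℕ | s k ∈ Λ}.Infinite) (r : ℕ → S) (τ₀ : ℤ) (σ₀ : S) {k : ℕ}
    (hk : s k ∈ Λ) : sigma r (hitTimes Λ s) τ₀ σ₀ k = r k := by
  rw [sigma, if_pos ((hitTimes_zero_le_iff h k).2 ⟨k, le_rfl, hk⟩), tau_of_mem h τ₀ hk,
    Int.toNat_natCast]

theorem hitTimes_zero_le_succ_iff_of_notMem (h : {k : ℕ | s k ∈ Λ}.Infinite) {k : ℕ}
    (hk : s (k + 1) ∉ Λ) : hitTimes Λ s 0 ≤ k + 1 ↔ hitTimes Λ s 0 ≤ k := by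
  refine ⟨fun hle => ?_, fun hle => hle.trans k.le_succ⟩
  obtain ⟨l, hl, hs⟩ := (hitTimes_zero_le_iff h _).1 hle
  refine (hitTimes_zero_le_iff h _).2 ⟨l, Nat.le_of_lt_succ (lt_of_le_of_ne hl ?_), hs⟩
  rintro rfl
  exact hk hs

theorem tau_succ_of_notMem (h : {k : ℕ | s k ∈ Λ}.Infinite) (τ₀ : ℤ) {k : ℕ}
    (hk : s (k + 1) ∉ Λ) : tau (hitTimes Λ s) τ₀ (k + 1) = tau (hitTimes Λ s) τ₀ k := by
  have hset : {l | s l ∈ Λ ∧ l ≤ k + 1} = {l | s l ∈ Λ ∧ l ≤ k} := by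
    ext l
    refine ⟨fun hl => ⟨hl.1, Nat.le_of_lt_succ (lt_of_le_of_ne hl.2 ?_)⟩,
      fun hl => ⟨hl.1, hl.2.trans k.le_succ⟩⟩
    rintro rfl
    exact hk hl.1
  simp only [tau, hitTimes_zero_le_succ_iff_of_notMem h hk, setOf_hitTimes_le h, hset]

theorem sigma_succ_of_notMem (h : {k : ℕ | s k ∈ Λ}.Infinite) (r : ℕ → S) (τ₀ : ℤ) (σ₀ : S) {k : ℕ}
    (hk : s (k + 1) ∉ Λ) :
    sigma r (hitTimes Λ s) τ₀ σ₀ (k + 1) = sigma r (hitTimes Λ s) τ₀ σ₀ k := by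
  simp only [sigma, hitTimes_zero_le_succ_iff_of_notMem h hk, tau_succ_of_notMem h τ₀ hk]

theorem not_hitTimes_zero_le_zero (h : {k : ℕ | s k ∈ Λ}.Infinite) (h0 : s 0 ∉ Λ) :
    ¬ hitTimes Λ s 0 ≤ 0 := by
  rw [hitTimes_zero_le_iff h]
  rintro ⟨l, hl, hs⟩
  obtain rfl := Nat.le_zero.1 hl
  exact h0 hs

end ObservationTimes

/-! ### Identification of the closed loop with the jump system -/

section ClosedLoop

variable {n m N M T : ℕ}

/-- The fictitious state at time -1 carries the phase ⌊-τ₀⌋_T, which one step without observation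
turns into ⌊0+1-τ₀⌋_T. Its first two entries are placeholders that `nextExt` never reads. -/
theorem extPath_eq [NeZero T] {Λ : Set (OneTo M)} (r : ℕ → OneTo N) {s : ℕ → OneTo M}
    (h : {k : ℕ | s k ∈ Λ}.Infinite) (τ₀ : ℤ) (σ₀ : OneTo N) (s₀ : OneTo M) (k : ℕ) :
    extPath Λ (σ₀, s₀, σ₀, floorMod T (-τ₀)) (fun j => (r j, s j)) k =
      (r k, s k, sigma r (hitTimes Λ s) τ₀ σ₀ k,
        floorMod T ((k : ℤ) + 1 - tau (hitTimes Λ s) τ₀ k)) := by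
  induction k with
  | zero =>
    by_cases h0 : s 0 ∈ Λ
    · simp [extPath, nextExt, h0, sigma_of_mem h r τ₀ σ₀ h0, tau_of_mem h τ₀ h0]
    · have ht := not_hitTimes_zero_le_zero h h0
      simp only [extPath, nextExt, h0, if_false, sigma, tau, ht, floorMod_floorMod_add_one]
      congr 4
      push_cast
      ring
  | succ k ih =>
    rw [extPath, ih]
    by_cases hk : s (k + 1) ∈ Λ
    · simp [nextExt, hk, sigma_of_mem h r τ₀ σ₀ hk, tau_of_mem h τ₀ hk]
    · simp only [nextExt, hk, if_false, sigma_succ_of_notMem h r τ₀ σ₀ hk,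
        tau_succ_of_notMem h τ₀ hk, floorMod_floorMod_add_one]
      congr 4
      push_cast
      ring

theorem closedLoop_eq_jumpState [NeZero T] {Λ : Set (OneTo M)}
    (A : OneTo N → Matrix (Fin n) (Fin n) ℝ) (B : OneTo N → Matrix (Fin n) (Fin m) ℝ)
    (K : OneTo N → OneTo T → Matrix (Fin m) (Fin n) ℝ) (r : ℕ → OneTo N) {s : ℕ → OneTo M}
    (h : {k : ℕ | s k ∈ Λ}.Infinite) (τ₀ : ℤ) (σ₀ : OneTo N) (s₀ : OneTo M)
    (x₀ : EuclideanSpace ℝ (Fin n)) (k : ℕ) :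
    (closedLoop A B K r (hitTimes Λ s) τ₀ σ₀ x₀ k).ofLp =
      jumpState (fun χ : ExtState N M T => A χ.1 + B χ.1 * K χ.2.2.1 χ.2.2.2) Λ
        (σ₀, s₀, σ₀, floorMod T (-τ₀)) x₀.ofLp (fun j => (r j, s j)) k := by
  induction k with
  | zero => rfl
  | succ k ih => rw [closedLoop, jumpState, extPath_eq r h, Matrix.toLpLin_apply, ih]

end ClosedLoop

/-! ### Moment recursion and exponential decay -/

section MeanSquareStability

variable {n m N M T : ℕ} {Ω : Type*} [MeasurableSpace Ω] {μ : Measure Ω}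

/-- The second moment of `v ⬝ H_χ x(k)` on the event that the extended chain is in `χ` at
time `k`. -/
noncomputable def stateMoment [NeZero T] (μ : Measure Ω)
    (H : ExtState N M T → Matrix (Fin n) (Fin n) ℝ) (Λ : Set (OneTo M)) (χ₀ : ExtState N M T)
    (x₀ : Fin n → ℝ) (X : ℕ → Ω → OneTo N × OneTo M) (k : ℕ) (χ : ExtState N M T)
    (v : Fin n → ℝ) : ℝ :=
  ∫ ω, (v ⬝ᵥ H χ *ᵥ jumpState H Λ χ₀ x₀ (fun j => X j ω) k) ^ 2 *
    (if extPath Λ χ₀ (fun j => X j ω) k = χ then 1 else 0) ∂μ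

theorem dependsOnHistory_stateMoment {Ω : Type*} [NeZero T]
    (H : ExtState N M T → Matrix (Fin n) (Fin n) ℝ)
    (Λ : Set (OneTo M)) (χ₀ : ExtState N M T) (x₀ : Fin n → ℝ) (X : ℕ → Ω → OneTo N × OneTo M)
    (k : ℕ) (χ : ExtState N M T) (v : Fin n → ℝ) :
    DependsOnHistory X k fun ω => (v ⬝ᵥ H χ *ᵥ jumpState H Λ χ₀ x₀ (fun j => X j ω) k) ^ 2 *
      (if extPath Λ χ₀ (fun j => X j ω) k = χ then 1 else 0 : ℝ) := fun ω ω' h => by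
  simp only [extPath_congr Λ χ₀ h, jumpState_congr H Λ χ₀ x₀ h]

/-- This is Y_χ(k+1) = H_χ 𝒟_χ(Y(k)) H_χᵀ read as quadratic forms, with H_χ moved onto `v` by
transposition. -/
theorem stateMoment_succ [NeZero T] [IsProbabilityMeasure μ] {P : Matrix (OneTo N) (OneTo N) ℝ}
    {Q : Matrix (OneTo M) (OneTo M) ℝ} {z₀ : OneTo N × OneTo M} {X : ℕ → Ω → OneTo N × OneTo M}
    (hX : IsMarkovChain μ
      (Matrix.of fun a b : OneTo N × OneTo M => P a.1 b.1 * Q a.2 b.2) z₀ X)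
    (H : ExtState N M T → Matrix (Fin n) (Fin n) ℝ) (Λ : Set (OneTo M)) (χ₀ : ExtState N M T)
    (x₀ : Fin n → ℝ) (k : ℕ) (χ : ExtState N M T) (v : Fin n → ℝ) :
    stateMoment μ H Λ χ₀ x₀ X (k + 1) χ v =
      ∑ χ', extTrans P Q Λ χ' χ * stateMoment μ H Λ χ₀ x₀ X k χ' ((H χ)ᵀ *ᵥ v) := by
  set f : ExtState N M T → Ω → ℝ := fun χ' ω =>
    (((H χ)ᵀ *ᵥ v) ⬝ᵥ H χ' *ᵥ jumpState H Λ χ₀ x₀ (fun j => X j ω) k) ^ 2 *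
      (if extPath Λ χ₀ (fun j => X j ω) k = χ' then 1 else 0) with hf
  have hdep : ∀ χ', DependsOnHistory X k (f χ') := fun χ' =>
    dependsOnHistory_stateMoment H Λ χ₀ x₀ X k χ' _
  have hdep' : ∀ χ', DependsOnHistory X (k + 1)
      fun ω => f χ' ω * (if X (k + 1) ω = (χ.1, χ.2.1) then 1 else 0) := fun χ' ω ω' h => by
    simp only [hdep χ' ω ω' fun l hl => h l (hl.trans k.le_succ), h (k + 1) le_rfl]
  -- Split by the previous extended state χ'. As χ records (r, s), reaching it from χ' means a
  -- prescribed value of `X (k + 1)` together with a nonrandom compatibility condition.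
  have hstep : ∀ ω, (v ⬝ᵥ H χ *ᵥ jumpState H Λ χ₀ x₀ (fun j => X j ω) (k + 1)) ^ 2 *
      (if extPath Λ χ₀ (fun j => X j ω) (k + 1) = χ then 1 else 0) =
      ∑ χ', (if nextExt Λ χ' (χ.1, χ.2.1) = χ then 1 else 0) *
        (f χ' ω * (if X (k + 1) ω = (χ.1, χ.2.1) then 1 else 0)) := fun ω => by
    rw [Finset.sum_eq_single (extPath Λ χ₀ (fun j => X j ω) k)
      (fun χ' _ hne => by simp [hf, hne.symm]) (by simp)]
    simp only [hf, if_true, mul_one, jumpState, extPath]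
    rw [mulVec_transpose, ← dotProduct_mulVec]
    by_cases hz : X (k + 1) ω = (χ.1, χ.2.1)
    · simp only [hz, if_true, mul_one]
      exact mul_comm _ _
    · have : nextExt Λ (extPath Λ χ₀ (fun j => X j ω) k) (X (k + 1) ω) ≠ χ := fun h => by
        refine hz (Prod.ext ?_ ?_)
        · rw [← nextExt_fst Λ (extPath Λ χ₀ (fun j => X j ω) k) (X (k + 1) ω), h]
        · rw [← nextExt_snd Λ (extPath Λ χ₀ (fun j => X j ω) k) (X (k + 1) ω), h]
      simp [hz, this]
  rw [stateMoment]
  simp only [hstep]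
  rw [integral_finsetSum _ fun χ' _ => ((hdep' χ').integrable hX.measurable).const_mul _]
  refine Finset.sum_congr rfl fun χ' _ => ?_
  have hsupp : ∀ ω, f χ' ω ≠ 0 → X k ω = (χ'.1, χ'.2.1) := fun ω hω => by
    have h : extPath Λ χ₀ (fun j => X j ω) k = χ' := by
      by_contra hne
      exact hω (by simp [hf, hne])
    rw [← h, extPath_fst, extPath_snd]
  rw [integral_const_mul, hX.integral_mul_indicator_succ (hdep χ') hsupp, extTrans_eq_ite,
    Matrix.of_apply, ← mul_assoc, ite_mul, one_mul, zero_mul]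
  rfl

/-- Nonnegative transition weights let the bound pass through 𝒟, after which `hHε` supplies one more
factor `ε`. -/
theorem stateMoment_le [NeZero T] [IsProbabilityMeasure μ] {P : Matrix (OneTo N) (OneTo N) ℝ}
    {Q : Matrix (OneTo M) (OneTo M) ℝ} (hP : ∀ i j, 0 ≤ P i j) (hQ : ∀ i j, 0 ≤ Q i j)
    {z₀ : OneTo N × OneTo M} {X : ℕ → Ω → OneTo N × OneTo M}
    (hX : IsMarkovChain μ
      (Matrix.of fun a b : OneTo N × OneTo M => P a.1 b.1 * Q a.2 b.2) z₀ X)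
    {H : ExtState N M T → Matrix (Fin n) (Fin n) ℝ} {Λ : Set (OneTo M)}
    {R : ExtState N M T → Matrix (Fin n) (Fin n) ℝ} {C ε : ℝ} (hC : 0 ≤ C) (hε : 0 ≤ ε)
    (hR : ∀ χ v, 0 ≤ v ⬝ᵥ R χ *ᵥ v)
    (hHC : ∀ χ v, v ⬝ᵥ (H χ * (H χ)ᵀ) *ᵥ v ≤ C * (v ⬝ᵥ R χ *ᵥ v))
    (hHε : ∀ χ v, ((H χ)ᵀ *ᵥ v) ⬝ᵥ calD P Q Λ R χ *ᵥ ((H χ)ᵀ *ᵥ v) ≤ ε * (v ⬝ᵥ R χ *ᵥ v))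
    (χ₀ : ExtState N M T) (x₀ : Fin n → ℝ) (k : ℕ) (χ : ExtState N M T) (v : Fin n → ℝ) :
    stateMoment μ H Λ χ₀ x₀ X k χ v ≤ C * ε ^ k * (x₀ ⬝ᵥ x₀) * (v ⬝ᵥ R χ *ᵥ v) := by
  have hx : 0 ≤ x₀ ⬝ᵥ x₀ := Finset.sum_nonneg fun i _ => mul_self_nonneg _
  induction k generalizing χ v with
  | zero =>
    -- Cauchy–Schwarz for `(H χ)ᵀ *ᵥ v` and `x₀`, then `hHC`.
    have hcs : (v ⬝ᵥ H χ *ᵥ x₀) ^ 2 ≤ C * (x₀ ⬝ᵥ x₀) * (v ⬝ᵥ R χ *ᵥ v) := by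
      have h1 := Finset.sum_mul_sq_le_sq_mul_sq Finset.univ ((H χ)ᵀ *ᵥ v) x₀
      have h2 := hHC χ v
      rw [← mulVec_mulVec, dotProduct_mulVec, ← mulVec_transpose] at h2
      rw [dotProduct_mulVec, ← mulVec_transpose]
      have h3 := mul_le_mul_of_nonneg_right h2 hx
      simp only [dotProduct, ← pow_two] at h1 h3 ⊢
      linarith
    have h0 : 0 ≤ C * (x₀ ⬝ᵥ x₀) * (v ⬝ᵥ R χ *ᵥ v) := mul_nonneg (mul_nonneg hC hx) (hR χ v)
    rw [pow_zero, mul_one, stateMoment]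
    refine (integral_mono
      ((dependsOnHistory_stateMoment H Λ χ₀ x₀ X 0 χ v).integrable hX.measurable)
      (integrable_const (C * (x₀ ⬝ᵥ x₀) * (v ⬝ᵥ R χ *ᵥ v))) fun ω => ?_).trans (by simp)
    simp only [jumpState]
    split_ifs
    · simpa using hcs
    · simpa using h0
  | succ k ih =>
    rw [stateMoment_succ hX]
    calc ∑ χ', extTrans P Q Λ χ' χ * stateMoment μ H Λ χ₀ x₀ X k χ' ((H χ)ᵀ *ᵥ v)
        ≤ ∑ χ', extTrans P Q Λ χ' χ * (C * ε ^ k * (x₀ ⬝ᵥ x₀) *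
            (((H χ)ᵀ *ᵥ v) ⬝ᵥ R χ' *ᵥ ((H χ)ᵀ *ᵥ v))) :=
          Finset.sum_le_sum fun χ' _ =>
            mul_le_mul_of_nonneg_left (ih _ _) (extTrans_nonneg hP hQ Λ χ' χ)
      _ = C * ε ^ k * (x₀ ⬝ᵥ x₀) *
            (((H χ)ᵀ *ᵥ v) ⬝ᵥ calD P Q Λ R χ *ᵥ ((H χ)ᵀ *ᵥ v)) := by
          rw [dotProduct_calD_mulVec, Finset.mul_sum]
          exact Finset.sum_congr rfl fun χ' _ => by ring
      _ ≤ C * ε ^ k * (x₀ ⬝ᵥ x₀) * (ε * (v ⬝ᵥ R χ *ᵥ v)) :=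
          mul_le_mul_of_nonneg_left (hHε χ v) (by positivity)
      _ = _ := by ring

theorem integrable_jumpState [NeZero T] [IsProbabilityMeasure μ]
    {X : ℕ → Ω → OneTo N × OneTo M} (hX : ∀ k, Measurable (X k))
    (H : ExtState N M T → Matrix (Fin n) (Fin n) ℝ) (Λ : Set (OneTo M)) (χ₀ : ExtState N M T)
    (x₀ : Fin n → ℝ) (k : ℕ) :
    Integrable (fun ω => jumpState H Λ χ₀ x₀ (fun j => X j ω) k ⬝ᵥ
      jumpState H Λ χ₀ x₀ (fun j => X j ω) k) μ :=
  DependsOnHistory.integrable (k := k) hX fun ω ω' h => by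
    simp only [jumpState_congr H Λ χ₀ x₀ h]

/-- A trace formula: the squared norm is summed over coordinates, and the events χ(k) = χ partition
the space. -/
theorem integral_jumpState_succ [NeZero T] [IsProbabilityMeasure μ]
    {X : ℕ → Ω → OneTo N × OneTo M} (hX : ∀ k, Measurable (X k))
    (H : ExtState N M T → Matrix (Fin n) (Fin n) ℝ) (Λ : Set (OneTo M)) (χ₀ : ExtState N M T)
    (x₀ : Fin n → ℝ) (k : ℕ) :
    ∫ ω, jumpState H Λ χ₀ x₀ (fun j => X j ω) (k + 1) ⬝ᵥ
      jumpState H Λ χ₀ x₀ (fun j => X j ω) (k + 1) ∂μ =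
      ∑ i, ∑ χ, stateMoment μ H Λ χ₀ x₀ X k χ (Pi.single i 1) := by
  simp only [stateMoment]
  have hint : ∀ i χ, Integrable _ μ := fun i χ =>
    (dependsOnHistory_stateMoment H Λ χ₀ x₀ X k χ (Pi.single i 1)).integrable hX
  simp only [← integral_finsetSum Finset.univ fun χ _ => hint _ χ]
  rw [← integral_finsetSum Finset.univ fun i _ =>
    integrable_finsetSum Finset.univ fun χ _ => hint i χ]
  refine integral_congr_ae (.of_forall fun ω => Finset.sum_congr rfl fun i _ => ?_)
  simp [jumpState, pow_two]

/-- The constants are fixed before the chain and the initial data, which gives the uniformity that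
stabilization demands. -/
theorem exists_integral_jumpState_le [NeZero T] [IsProbabilityMeasure μ]
    {P : Matrix (OneTo N) (OneTo N) ℝ} {Q : Matrix (OneTo M) (OneTo M) ℝ}
    (hP : ∀ i j, 0 ≤ P i j) (hQ : ∀ i j, 0 ≤ Q i j)
    {H : ExtState N M T → Matrix (Fin n) (Fin n) ℝ} {Λ : Set (OneTo M)}
    {R : ExtState N M T → Matrix (Fin n) (Fin n) ℝ} (hR : ∀ χ v, v ≠ 0 → 0 < v ⬝ᵥ R χ *ᵥ v)
    (hHR : ∀ χ v, v ≠ 0 →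
      ((H χ)ᵀ *ᵥ v) ⬝ᵥ calD P Q Λ R χ *ᵥ ((H χ)ᵀ *ᵥ v) < v ⬝ᵥ R χ *ᵥ v) :
    ∃ C > (0 : ℝ), ∃ ε ∈ Set.Ico (0 : ℝ) 1, ∀ (z₀ : OneTo N × OneTo M)
      (X : ℕ → Ω → OneTo N × OneTo M), IsMarkovChain μ
      (Matrix.of fun a b : OneTo N × OneTo M => P a.1 b.1 * Q a.2 b.2) z₀ X →
      ∀ (χ₀ : ExtState N M T) (x₀ : Fin n → ℝ) (k : ℕ),
        ∫ ω, jumpState H Λ χ₀ x₀ (fun j => X j ω) k ⬝ᵥ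
          jumpState H Λ χ₀ x₀ (fun j => X j ω) k ∂μ ≤ C * ε ^ k * (x₀ ⬝ᵥ x₀) := by
  have hR0 : ∀ χ v, 0 ≤ v ⬝ᵥ R χ *ᵥ v := fun χ v => by
    by_cases hv : v = 0
    · simp [hv]
    · exact (hR χ v hv).le
  obtain ⟨c, hc⟩ : ∃ c : ℝ, 0 < c ∧
      ∀ χ v, v ⬝ᵥ (H χ * (H χ)ᵀ) *ᵥ v ≤ c * (v ⬝ᵥ R χ *ᵥ v) := by
    -- For each of the finitely many χ every large `c` works, so a common one exists; likewise below
    -- for `ε` close to 1 from the left.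
    refine ((Filter.eventually_gt_atTop 0).and (Filter.eventually_all.2 fun χ => ?_)).exists
      (f := Filter.atTop)
    obtain ⟨C, -, hC⟩ := exists_quadForm_le (H χ * (H χ)ᵀ) (R χ) (hR χ)
    filter_upwards [Filter.eventually_ge_atTop C] with c hc v
    exact (hC v).trans (mul_le_mul_of_nonneg_right hc (hR0 χ v))
  obtain ⟨ε, ⟨hε0, hε1⟩, hε⟩ : ∃ ε : ℝ, (0 < ε ∧ ε < 1) ∧ ∀ χ v,
      ((H χ)ᵀ *ᵥ v) ⬝ᵥ calD P Q Λ R χ *ᵥ ((H χ)ᵀ *ᵥ v) ≤ ε * (v ⬝ᵥ R χ *ᵥ v) := by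
    refine (Filter.Eventually.and (Ioo_mem_nhdsLT one_pos)
      (Filter.eventually_all.2 fun χ => ?_)).exists (f := nhdsWithin 1 (Set.Iio 1))
    have hconj : ∀ v, v ⬝ᵥ (H χ * calD P Q Λ R χ * (H χ)ᵀ) *ᵥ v =
        ((H χ)ᵀ *ᵥ v) ⬝ᵥ calD P Q Λ R χ *ᵥ ((H χ)ᵀ *ᵥ v) := fun v => by
      rw [← mulVec_mulVec, ← mulVec_mulVec, dotProduct_mulVec, ← mulVec_transpose]
    obtain ⟨e, he, h⟩ := exists_quadForm_le_contraction (H χ * calD P Q Λ R χ * (H χ)ᵀ) (R χ)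
      fun v hv => (hconj v).trans_lt (hHR χ v hv)
    filter_upwards [Ioo_mem_nhdsLT he] with ε hε v
    rw [← hconj]
    exact (h v).trans (mul_le_mul_of_nonneg_right hε.1.le (hR0 χ v))
  set S : ℝ := ∑ i, ∑ χ, (Pi.single i 1 : Fin n → ℝ) ⬝ᵥ R χ *ᵥ Pi.single i 1 with hS
  have hS0 : 0 ≤ S := Finset.sum_nonneg fun i _ => Finset.sum_nonneg fun χ _ => hR0 χ _
  -- The moments at time `k` control the state at `k + 1`, hence the division by `ε`; the summand 1
  -- covers time 0.
  refine ⟨1 + c * S / ε, by have := hc.1; positivity, ε, ⟨hε0.le, hε1⟩,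
    fun z₀ X hX χ₀ x₀ k => ?_⟩
  have hx : 0 ≤ x₀ ⬝ᵥ x₀ := Finset.sum_nonneg fun i _ => mul_self_nonneg _
  cases k with
  | zero =>
    simp only [jumpState, integral_const, probReal_univ, one_smul, pow_zero, mul_one]
    have : 0 ≤ c * S / ε * (x₀ ⬝ᵥ x₀) := by have := hc.1; positivity
    linarith
  | succ k =>
    rw [integral_jumpState_succ hX.measurable]
    calc ∑ i, ∑ χ, stateMoment μ H Λ χ₀ x₀ X k χ (Pi.single i 1)
        ≤ ∑ i, ∑ χ, c * ε ^ k * (x₀ ⬝ᵥ x₀) *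
            ((Pi.single i 1 : Fin n → ℝ) ⬝ᵥ R χ *ᵥ Pi.single i 1) :=
          Finset.sum_le_sum fun i _ => Finset.sum_le_sum fun χ _ =>
            stateMoment_le hP hQ hX hc.1.le hε0.le hR0 hc.2 hε χ₀ x₀ k χ _
      _ = c * ε ^ k * (x₀ ⬝ᵥ x₀) * S := by simp only [hS, Finset.mul_sum]
      _ = c * S / ε * ε ^ (k + 1) * (x₀ ⬝ᵥ x₀) := by
          field_simp
          ring
      _ ≤ _ := by
          gcongr
          linarith

end MeanSquareStability

end MJLS

/-! ### The stabilization theorem -/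

theorem mainTheorem3
    {n m N M T : ℕ} [NeZero M] [NeZero T]
    {Ω : Type*} [MeasurableSpace Ω] (μ : Measure Ω) [IsProbabilityMeasure μ]
    (A : MJLS.OneTo N → Matrix (Fin n) (Fin n) ℝ) (B : MJLS.OneTo N → Matrix (Fin n) (Fin m) ℝ)
    (P : Matrix (MJLS.OneTo N) (MJLS.OneTo N) ℝ) (Q : Matrix (MJLS.OneTo M) (MJLS.OneTo M) ℝ)
    (hP : P ∈ Matrix.rowStochastic ℝ (MJLS.OneTo N))
    (hQ : Q ∈ Matrix.rowStochastic ℝ (MJLS.OneTo M))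
    (r : MJLS.OneTo N → ℕ → Ω → MJLS.OneTo N) (s : MJLS.OneTo M → ℕ → Ω → MJLS.OneTo M)
    (hr : ∀ r₀, MJLS.IsMarkovChain μ P r₀ (r r₀))
    (hs : ∀ s₀, MJLS.IsMarkovChain μ Q s₀ (s s₀))
    (hrs : ∀ r₀ s₀, IndepFun (fun ω k => r r₀ k ω) (fun ω k => s s₀ k ω) μ)
    (Λ : Set (MJLS.OneTo M)) (hΛ : MJLS.IsRecurrentSet μ s Λ)
    (R : MJLS.ExtState N M T → Matrix (Fin n) (Fin n) ℝ)
    (G : MJLS.OneTo N → MJLS.OneTo T → Matrix (Fin n) (Fin n) ℝ)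
    (F : MJLS.OneTo N → MJLS.OneTo T → Matrix (Fin m) (Fin n) ℝ)
    (hLMI : ∀ (α : MJLS.OneTo N) (β : MJLS.OneTo M) (γ : MJLS.OneTo N) (δ : MJLS.OneTo T),
      (Matrix.fromBlocks
        (R (α, β, γ, δ))
        (A α * G γ δ + B α * F γ δ)
        ((G γ δ)ᵀ * (A α)ᵀ + (F γ δ)ᵀ * (B α)ᵀ)
        (G γ δ + (G γ δ)ᵀ - MJLS.calD P Q Λ R (α, β, γ, δ))).PosDef) :
    (∀ γ δ, IsUnit (G γ δ)) ∧
      MJLS.Stabilizes μ A B r (MJLS.inducedObs s Λ) (fun γ δ => F γ δ * (G γ δ)⁻¹) := by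
  have hP0 := hP.1
  have hQ0 := hQ.1
  have hR : ∀ χ v, v ≠ 0 → 0 < v ⬝ᵥ R χ *ᵥ v := fun χ v hv => by
    simpa using MJLS.quadForm_pos_of_fromBlocks (hLMI χ.1 χ.2.1 χ.2.2.1 χ.2.2.2) (v := v) (w := 0)
      (Or.inl hv)
  have hD : ∀ χ v, 0 ≤ v ⬝ᵥ MJLS.calD P Q Λ R χ *ᵥ v := fun χ v => by
    rw [MJLS.dotProduct_calD_mulVec]
    refine Finset.sum_nonneg fun χ' _ => mul_nonneg (MJLS.extTrans_nonneg hP0 hQ0 Λ χ' χ) ?_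
    by_cases hv : v = 0
    · simp [hv]
    · exact (hR χ' v hv).le
  have hG : ∀ γ δ, IsUnit (G γ δ) := fun γ δ => by
    -- `G γ δ` involves neither α nor β, so any block with these γ and δ serves.
    let β : MJLS.OneTo M := ⟨1, Finset.mem_Icc.2 ⟨le_rfl, NeZero.one_le⟩⟩
    exact MJLS.isUnit_of_quadForm_pos (hD (γ, β, γ, δ)) fun w hw => by
      simpa using MJLS.quadForm_pos_of_fromBlocks (hLMI γ β γ δ) (v := 0) (w := w) (Or.inr hw)
  refine ⟨hG, ?_⟩
  obtain ⟨C, hC, ε, hε, h⟩ := MJLS.exists_integral_jumpState_le (μ := μ) (Λ := Λ) hP0 hQ0 hR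
    (H := fun χ => A χ.1 + B χ.1 * (F χ.2.2.1 χ.2.2.2 * (G χ.2.2.1 χ.2.2.2)⁻¹))
    fun χ v hv => MJLS.quadForm_transpose_lt_of_fromBlocks (hG _ _)
      (hLMI χ.1 χ.2.1 χ.2.2.1 χ.2.2.2) v hv
  refine ⟨C, hC, ε, hε, ?_⟩
  rintro x₀ r₀ τ₀ σ₀ - _ ⟨s₀, rfl⟩ k
  have hX := (hr r₀).prod (hs s₀) (hrs r₀ s₀)
  have hnorm : ∀ x : EuclideanSpace ℝ (Fin n), ‖x‖ ^ 2 = x.ofLp ⬝ᵥ x.ofLp := fun x => by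
    rw [EuclideanSpace.real_norm_sq_eq]
    simp [dotProduct, pow_two]
  -- The two systems agree only where `Λ` is visited infinitely often; recurrence makes this almost
  -- sure.
  have hae := (hΛ s₀).mono fun ω hω => (hnorm _).trans (by
    rw [MJLS.closedLoop_eq_jumpState A B (fun γ δ => F γ δ * (G γ δ)⁻¹) (fun j => r r₀ j ω) hω
      τ₀ σ₀ s₀ x₀ k])
  rw [hnorm]
  exact ⟨(MJLS.integrable_jumpState hX.measurable _ _ _ _ k).congr
    (Filter.EventuallyEq.symm hae), (integral_congr_ae hae).trans_le (h _ _ hX _ _ k)⟩
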